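/- For $\theta\in[0,2\pi)$ let $O(\theta)=\begin{bmatrix}\cos(\theta/2)&-\sin(\theta/2)\\ \sin(\theta/2)&\cos(\theta/2)\end{bmatrix}$ and, for $r\in[0,1]$, let $\rho(r,\theta)=O(\theta)\begin{bmatrix}r&0\\0&1-r\end{bmatrix}O(\theta)^\top$, a $2\times2$ density matrix. For $2\times 2$ density matrices $\rho^A,\rho^B$ let $\Gamma^Q(\rho^A,\rho^B)$ be the set of density matrices $R$ (positive semidefinite, trace one) on $\mathbb C^2\otimes\mathbb C^2$ whose partial traces over the second and the first factor are $\rho^A$ and $\rho^B$, respectively. Let $C^Q=\tfrac12(\mathbb I-S)$, where $S$ is the SWAP operator $x\otimes y\mapsto y\otimes x$, and let $$\mathrm T^Q_{C^Q}(\rho^A,\rho^B)=\min_{R\in\Gamma^Q(\rho^A,\rho^B)}\operatorname{tr}(C^QR).$$ Let $0<r,s<1$, $\theta\in[0,2\pi)$, $\rho^A=\rho(s,0)$ and $\rho^B=\rho(r,\theta)$. Then the minimum defining $\mathrm T^Q_{C^Q}(\rho^A,\rho^B)$ is attained and $$\mathrm T^Q_{C^Q}(\rho^A,\rho^B)=\max_{\phi\in\Phi(s,r,\theta)}\frac14\Big(\sqrt{1+(2s-1)\cos\phi}-\sqrt{1+(2r-1)\cos(\theta+\phi)}\Big)^2,$$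 where the maximum is attained and $\Phi(s,r,\theta)$ is the set of all $\phi\in[0,2\pi)$ satisfying $$\frac{(2s-1)^2\sin^2\phi}{1+(2s-1)\cos\phi}=\frac{(2r-1)^2\sin^2(\theta+\phi)}{1+(2r-1)\cos(\theta+\phi)}.\qquad(*)$$ Moreover, with $\zeta=e^{i\theta}$, a real number $\phi$ satisfies $(*)$ if and only if $z=e^{i\phi}$ is a root of $$P(z)=(1-2r)^2\big[(2s-1)(z^2+1)+2z\big](\zeta^2z^2-1)^2-\zeta(1-2s)^2(z^2-1)^2\big[(2r-1)(\zeta^2z^2+1)+2\zeta z\big],$$ a polynomial of degree at most $6$. If $\rho^A\neq\rho^B$, then $P\neq0$ and $\Phi(s,r,\theta)$ has at most six elements. -/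

import Mathlib

open scoped Matrix ComplexOrder

namespace QuantumTransport

/-- Density matrices: Hermitian positive semidefinite complex matrices of trace one. -/
def IsDensity {n : Type*} [Fintype n] (ρ : Matrix n n ℂ) : Prop :=
  ρ.PosSemidef ∧ ρ.trace = 1

/-- The partial trace over the second tensor factor. -/
def traceB {m n : Type*} [Fintype n] (R : Matrix (m × n) (m × n) ℂ) : Matrix m m ℂ :=
  Matrix.of fun i j => ∑ p, R (i, p) (j, p)

/-- The partial trace over the first tensor factor. -/
def traceA {m n : Type*} [Fintype m] (R : Matrix (m × n) (m × n) ℂ) : Matrix n n ℂ :=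
  Matrix.of fun p q => ∑ i, R (i, p) (i, q)

/-- The set of quantum couplings of `ρA` and `ρB`: bipartite density matrices whose
partial traces are `ρA` and `ρB`. -/
def couplings {m n : Type*} [Fintype m] [Fintype n]
    (ρA : Matrix m m ℂ) (ρB : Matrix n n ℂ) : Set (Matrix (m × n) (m × n) ℂ) :=
  {R | IsDensity R ∧ traceB R = ρA ∧ traceA R = ρB}

/-- The set of the transport costs `tr (C R)` of all couplings `R` of `ρA` and `ρB`.
For Hermitian `C` the number `tr (C R)` is real, so taking the real part loses nothing. -/
def costs {m n : Type*} [Fintype m] [Fintype n] (C : Matrix (m × n) (m × n) ℂ)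
    (ρA : Matrix m m ℂ) (ρB : Matrix n n ℂ) : Set ℝ :=
  (fun R => (C * R).trace.re) '' couplings ρA ρB

/-- The quantum optimal transport cost: the minimum of `tr (C R)` over all couplings. -/
noncomputable def transportCost {m n : Type*} [Fintype m] [Fintype n]
    (C : Matrix (m × n) (m × n) ℂ) (ρA : Matrix m m ℂ) (ρB : Matrix n n ℂ) : ℝ :=
  sInf (costs C ρA ρB)

/-- The SWAP operator, determined by `x ⊗ y ↦ y ⊗ x`. -/
def swapMatrix (n : Type*) [DecidableEq n] : Matrix (n × n) (n × n) ℂ :=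
  Matrix.of fun a b => if a = b.swap then 1 else 0

/-- The cost matrix `(1 - S) / 2`, the projection onto the skew-symmetric tensors. -/
noncomputable def swapCost (n : Type*) [DecidableEq n] : Matrix (n × n) (n × n) ℂ :=
  (1 / 2 : ℂ) • (1 - swapMatrix n)

/-- The rotation matrix by the angle `θ / 2`. -/
noncomputable def rot (θ : ℝ) : Matrix (Fin 2) (Fin 2) ℝ :=
  !![Real.cos (θ / 2), -Real.sin (θ / 2); Real.sin (θ / 2), Real.cos (θ / 2)]

/-- The qubit state `O(θ) diag(r, 1 - r) O(θ)ᵀ`. -/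
noncomputable def qubit (r θ : ℝ) : Matrix (Fin 2) (Fin 2) ℂ :=
  (rot θ * !![r, 0; 0, 1 - r] * (rot θ)ᵀ).map Complex.ofReal

/-- The trigonometric equation for the angle `φ`. For `0 < r, s < 1` both denominators
are positive. -/
def PhiEquation (s r θ φ : ℝ) : Prop :=
  (2 * s - 1) ^ 2 * Real.sin φ ^ 2 / (1 + (2 * s - 1) * Real.cos φ) =
    (2 * r - 1) ^ 2 * Real.sin (θ + φ) ^ 2 / (1 + (2 * r - 1) * Real.cos (θ + φ))

/-- The set of solutions of the trigonometric equation in `[0, 2π)`. -/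
def PhiSet (s r θ : ℝ) : Set ℝ :=
  {φ | φ ∈ Set.Ico 0 (2 * Real.pi) ∧ PhiEquation s r θ φ}

/-- The function of the angle `φ` that is maximized. -/
noncomputable def gFun (s r θ φ : ℝ) : ℝ :=
  1 / 4 * (√(1 + (2 * s - 1) * Real.cos φ) - √(1 + (2 * r - 1) * Real.cos (θ + φ))) ^ 2

open Polynomial in
/-- The polynomial in `z = exp (i φ)`, with `ζ = exp (i θ)`, equivalent to the trigonometric
equation. -/
noncomputable def phiPoly (s r θ : ℝ) : ℂ[X] :=
  let ζ : ℂ := Complex.exp (θ * Complex.I)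
  C ((1 - 2 * r : ℂ) ^ 2) * (C (2 * s - 1 : ℂ) * (X ^ 2 + 1) + 2 * X)
      * (C (ζ ^ 2) * X ^ 2 - 1) ^ 2
    - C (ζ * (1 - 2 * s : ℂ) ^ 2) * (X ^ 2 - 1) ^ 2
      * (C (2 * r - 1 : ℂ) * (C (ζ ^ 2) * X ^ 2 + 1) + C (2 * ζ) * X)

end QuantumTransport

/-!
Conjugating both states by the same rotation does not change the set of transport costs, because
the SWAP operator commutes with `U ⊗ U`. In any basis, the `2 × 2` principal minors of a coupling
and the triangle inequality bound its cost below by `(√p - √q) ^ 2 / 2`, where `p` and `q` are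
corresponding diagonal entries of the marginals; over all rotations this gives `gFun s r θ φ` for
every `φ`. At a maximizer `φ` the bound is attained. The first-order condition says that the ratio
`k` of the off-diagonal entry to the square root of the diagonal entry is the same for both rotated
states, so that the vector `(0, √p, √q, k)` has the right off-diagonal marginals; squaring this
condition yields the trigonometric equation. Comparing with one further rotation gives
`p + q + k ^ 2 ≤ 1`, so that the vector can be completed to a coupling of cost
`(√p - √q) ^ 2 / 2`.
-/

namespace QuantumTransport

open scoped Kronecker
open Real

section Invariance

variable {m n : Type*} [Fintype m] [Fintype n]

lemma trace_traceB_mul [DecidableEq n] (R : Matrix (m × n) (m × n) ℂ) (X : Matrix m m ℂ) :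
    (traceB R * X).trace = (R * X ⊗ₖ (1 : Matrix n n ℂ)).trace := by
  simp only [Matrix.trace, Matrix.diag, Matrix.mul_apply, traceB, Matrix.of_apply,
    Fintype.sum_prod_type, Matrix.kronecker_apply, Matrix.one_apply, mul_ite, mul_one, mul_zero,
    Finset.sum_ite_eq', Finset.mem_univ, if_true, Finset.sum_mul]
  exact Finset.sum_congr rfl fun _ _ => Finset.sum_comm

lemma traceB_kronecker_conj [DecidableEq n] (U : Matrix m m ℂ) {V : Matrix n n ℂ}
    (hV : Vᴴ * V = 1) (R : Matrix (m × n) (m × n) ℂ) :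
    traceB (U ⊗ₖ V * R * (U ⊗ₖ V)ᴴ) = U * traceB R * Uᴴ := by
  classical
  refine Matrix.ext_iff_trace_mul_right.2 fun X => ?_
  calc (traceB (U ⊗ₖ V * R * (U ⊗ₖ V)ᴴ) * X).trace
      = (U ⊗ₖ V * (R * (U ⊗ₖ V)ᴴ * X ⊗ₖ (1 : Matrix n n ℂ))).trace := by
        rw [trace_traceB_mul]; simp only [Matrix.mul_assoc]
    _ = (R * ((U ⊗ₖ V)ᴴ * X ⊗ₖ (1 : Matrix n n ℂ) * U ⊗ₖ V)).trace := by
        rw [Matrix.trace_mul_comm]; simp only [Matrix.mul_assoc]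
    _ = (R * (Uᴴ * X * U) ⊗ₖ (1 : Matrix n n ℂ)).trace := by
        rw [Matrix.conjTranspose_kronecker, ← Matrix.mul_kronecker_mul, ← Matrix.mul_kronecker_mul,
          Matrix.mul_one, hV]
    _ = (traceB R * Uᴴ * X * U).trace := by
        rw [← trace_traceB_mul]; simp only [Matrix.mul_assoc]
    _ = (U * traceB R * Uᴴ * X).trace := by
        rw [Matrix.trace_mul_comm]; simp only [Matrix.mul_assoc]

lemma traceA_kronecker_conj [DecidableEq m] {U : Matrix m m ℂ} (hU : Uᴴ * U = 1)
    (V : Matrix n n ℂ) (R : Matrix (m × n) (m × n) ℂ) :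
    traceA (U ⊗ₖ V * R * (U ⊗ₖ V)ᴴ) = V * traceA R * Vᴴ := by
  have hswap : (U ⊗ₖ V).submatrix Prod.swap Prod.swap = V ⊗ₖ U := by
    ext i j
    exact mul_comm _ _
  calc traceA (U ⊗ₖ V * R * (U ⊗ₖ V)ᴴ)
      = traceB ((U ⊗ₖ V * R * (U ⊗ₖ V)ᴴ).submatrix (Equiv.prodComm n m) (Equiv.prodComm n m)) :=
        rfl
    _ = traceB (V ⊗ₖ U * R.submatrix Prod.swap Prod.swap * (V ⊗ₖ U)ᴴ) := by
        simp only [← Matrix.submatrix_mul_equiv _ _ _ (Equiv.prodComm n m) _,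
          ← Matrix.conjTranspose_submatrix, Equiv.coe_prodComm, hswap]
    _ = V * traceA R * Vᴴ := traceB_kronecker_conj V hU _

variable [DecidableEq m] [DecidableEq n]

lemma conjTranspose_mul_kronecker {U : Matrix m m ℂ} {V : Matrix n n ℂ} (hU : Uᴴ * U = 1)
    (hV : Vᴴ * V = 1) : (U ⊗ₖ V)ᴴ * U ⊗ₖ V = 1 := by
  rw [Matrix.conjTranspose_kronecker, ← Matrix.mul_kronecker_mul, hU, hV, Matrix.one_kronecker_one]

lemma conj_mem_couplings {U : Matrix m m ℂ} {V : Matrix n n ℂ} (hU : Uᴴ * U = 1)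
    (hV : Vᴴ * V = 1) {A : Matrix m m ℂ} {B : Matrix n n ℂ} {R : Matrix (m × n) (m × n) ℂ}
    (hR : R ∈ couplings A B) :
    U ⊗ₖ V * R * (U ⊗ₖ V)ᴴ ∈ couplings (U * A * Uᴴ) (V * B * Vᴴ) := by
  obtain ⟨⟨hpos, htr⟩, hB, hA⟩ := hR
  refine ⟨⟨hpos.mul_mul_conjTranspose_same _, ?_⟩, ?_, ?_⟩
  · rw [Matrix.mul_assoc, Matrix.trace_mul_comm, Matrix.mul_assoc,
      conjTranspose_mul_kronecker hU hV, Matrix.mul_one, htr]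
  · rw [traceB_kronecker_conj U hV, hB]
  · rw [traceA_kronecker_conj hU, hA]

lemma costs_subset_costs_conj {U : Matrix m m ℂ} {V : Matrix n n ℂ} (hU : Uᴴ * U = 1)
    (hV : Vᴴ * V = 1) (C : Matrix (m × n) (m × n) ℂ) (A : Matrix m m ℂ) (B : Matrix n n ℂ) :
    costs C A B ⊆ costs (U ⊗ₖ V * C * (U ⊗ₖ V)ᴴ) (U * A * Uᴴ) (V * B * Vᴴ) := by
  rintro _ ⟨R, hR, rfl⟩
  refine ⟨_, conj_mem_couplings hU hV hR, congrArg Complex.re ?_⟩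
  calc (U ⊗ₖ V * C * (U ⊗ₖ V)ᴴ * (U ⊗ₖ V * R * (U ⊗ₖ V)ᴴ)).trace
      = (U ⊗ₖ V * (C * ((U ⊗ₖ V)ᴴ * U ⊗ₖ V) * R * (U ⊗ₖ V)ᴴ)).trace := by
        simp only [Matrix.mul_assoc]
    _ = (C * R * (U ⊗ₖ V)ᴴ * U ⊗ₖ V).trace := by
        rw [conjTranspose_mul_kronecker hU hV, Matrix.mul_one, Matrix.trace_mul_comm]
    _ = (C * R).trace := by
        rw [Matrix.mul_assoc, conjTranspose_mul_kronecker hU hV, Matrix.mul_one]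

lemma swapMatrix_mul_kronecker (A B : Matrix n n ℂ) :
    swapMatrix n * A ⊗ₖ B = B ⊗ₖ A * swapMatrix n := by
  ext ⟨i, j⟩ ⟨k, l⟩
  simp [swapMatrix, Matrix.mul_apply, Fintype.sum_prod_type, Prod.ext_iff, ite_and, mul_comm]

lemma kronecker_conj_swapCost {U : Matrix n n ℂ} (hU : U * Uᴴ = 1) :
    U ⊗ₖ U * swapCost n * (U ⊗ₖ U)ᴴ = swapCost n := by
  have hcomm : U ⊗ₖ U * swapCost n = swapCost n * U ⊗ₖ U := by
    simp only [swapCost, Matrix.mul_smul, Matrix.smul_mul, Matrix.mul_sub, Matrix.sub_mul,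
      Matrix.mul_one, Matrix.one_mul, swapMatrix_mul_kronecker]
  rw [hcomm, Matrix.mul_assoc, Matrix.conjTranspose_kronecker, ← Matrix.mul_kronecker_mul, hU,
    Matrix.one_kronecker_one, Matrix.mul_one]

lemma costs_swapCost_conj {U : Matrix n n ℂ} (hU : U ∈ Matrix.unitaryGroup n ℂ)
    (A B : Matrix n n ℂ) :
    costs (swapCost n) (U * A * Uᴴ) (U * B * Uᴴ) = costs (swapCost n) A B := by
  have hsub {V : Matrix n n ℂ} (hV : V ∈ Matrix.unitaryGroup n ℂ) (A B : Matrix n n ℂ) :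
      costs (swapCost n) A B ⊆ costs (swapCost n) (V * A * Vᴴ) (V * B * Vᴴ) := by
    have hV' : Vᴴ * V = 1 := Matrix.mem_unitaryGroup_iff'.1 hV
    simpa only [kronecker_conj_swapCost (Matrix.mem_unitaryGroup_iff.1 hV)] using
      costs_subset_costs_conj hV' hV' (swapCost n) A B
  have hinv (A : Matrix n n ℂ) : Uᴴ * (U * A * Uᴴ) * Uᴴᴴ = A := by
    have hU' : Uᴴ * U = 1 := Matrix.mem_unitaryGroup_iff'.1 hU
    rw [Matrix.conjTranspose_conjTranspose, Matrix.mul_assoc, Matrix.mul_assoc, hU',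
      Matrix.mul_one, ← Matrix.mul_assoc, hU', Matrix.one_mul]
  refine (hsub hU A B).antisymm' ?_
  simpa only [Matrix.star_eq_conjTranspose, hinv] using
    hsub (Unitary.star_mem hU) (U * A * Uᴴ) (U * B * Uᴴ)

end Invariance

section LowerBound

lemma sq_sqrt_sub_sqrt_le_of_posSemidef {ι : Type*} {M : Matrix ι ι ℂ} (hM : M.PosSemidef)
    (a b : ι) :
    (√(M a a).re - √(M b b).re) ^ 2 ≤ (M a a).re + (M b b).re - 2 * (M a b).re := by
  have ha := Complex.nonneg_iff.1 (hM.diag_nonneg (i := a))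
  have hb := Complex.nonneg_iff.1 (hM.diag_nonneg (i := b))
  have hminor : (M a b).re ^ 2 ≤ (M a a).re * (M b b).re := by
    have hdet := (Complex.nonneg_iff.1 (hM.submatrix ![a, b]).det_nonneg).1
    rw [Matrix.det_fin_two] at hdet
    simp only [Matrix.submatrix_apply, Matrix.cons_val_zero, Matrix.cons_val_one,
      Matrix.cons_val_fin_one, ← hM.1.apply b a, Complex.star_def, Complex.sub_re, Complex.mul_re,
      Complex.conj_re, Complex.conj_im, ← ha.2, ← hb.2] at hdet
    nlinarith [sq_nonneg (M a b).im]
  have hre : (M a b).re ≤ √(M a a).re * √(M b b).re := by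
    rw [← Real.sqrt_mul ha.1]
    exact Real.le_sqrt_of_sq_le hminor
  rw [sub_sq, Real.sq_sqrt ha.1, Real.sq_sqrt hb.1]
  linarith

variable {n : Type*} [Fintype n]

lemma sq_sqrt_sum_sub_sqrt_sum_le (f g : n → ℝ) :
    (√(∑ i, f i ^ 2) - √(∑ i, g i ^ 2)) ^ 2 ≤ ∑ i, (f i - g i) ^ 2 := by
  have h := abs_norm_sub_norm_le (WithLp.toLp 2 f) (WithLp.toLp 2 g)
  simp only [EuclideanSpace.norm_eq, PiLp.sub_apply, Real.norm_eq_abs, sq_abs] at h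
  rw [← sq_abs]
  exact (Real.le_sqrt (abs_nonneg _) (by positivity)).1 h

lemma two_mul_sum_le_sum_sum {d : n → n → ℝ} (hd : ∀ p q, 0 ≤ d p q)
    (hsymm : ∀ p q, d p q = d q p) (i : n) (hi : d i i = 0) :
    2 * ∑ q, d i q ≤ ∑ p, ∑ q, d p q := by
  classical
  have hrow : ∑ q, d i q = ∑ p ∈ Finset.univ.erase i, d p i := by
    rw [← Finset.add_sum_erase _ _ (Finset.mem_univ i), hi, zero_add]
    exact Finset.sum_congr rfl fun p _ => hsymm i p
  have hcol : ∑ p ∈ Finset.univ.erase i, d p i ≤ ∑ p ∈ Finset.univ.erase i, ∑ q, d p q :=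
    Finset.sum_le_sum fun p _ =>
      Finset.single_le_sum (fun q _ => hd p q) (Finset.mem_univ i)
  rw [← Finset.add_sum_erase _ (fun p => ∑ q, d p q) (Finset.mem_univ i)]
  linarith

variable [DecidableEq n]

lemma re_trace_swapCost_mul {R : Matrix (n × n) (n × n) ℂ} (hR : R.IsHermitian) :
    (swapCost n * R).trace.re = 1 / 4 * ∑ p, ∑ q, ((R (p, q) (p, q)).re + (R (q, p) (q, p)).re
      - 2 * (R (p, q) (q, p)).re) := by
  have hherm (p q : n) : (R (q, p) (p, q)).re = (R (p, q) (q, p)).re := by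
    rw [← hR.apply]; simp
  have hcomm : ∑ p, ∑ q, (R (q, p) (q, p)).re = ∑ p, ∑ q, (R (p, q) (p, q)).re :=
    Finset.sum_comm
  have htrace : (swapCost n * R).trace.re =
      1 / 2 * ∑ p, ∑ q, ((R (p, q) (p, q)).re - (R (p, q) (q, p)).re) := by
    simp [swapCost, Matrix.trace, Matrix.sub_mul, Fintype.sum_prod_type, swapMatrix,
      Matrix.mul_apply, Prod.ext_iff, ite_and, hherm, ← Finset.mul_sum]
  rw [htrace]
  simp only [Finset.sum_sub_distrib, Finset.sum_add_distrib, ← Finset.mul_sum, hcomm]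
  ring

lemma half_sq_sqrt_sub_sqrt_le {A B : Matrix n n ℂ} {c : ℝ} (hc : c ∈ costs (swapCost n) A B)
    (i : n) : (√(A i i).re - √(B i i).re) ^ 2 / 2 ≤ c := by
  obtain ⟨R, ⟨⟨hR, -⟩, rfl, rfl⟩, rfl⟩ := hc
  let d p q := (R (p, q) (p, q)).re + (R (q, p) (q, p)).re - 2 * (R (p, q) (q, p)).re
  have hsqrt (p q : n) : (√(R (p, q) (p, q)).re - √(R (q, p) (q, p)).re) ^ 2 ≤ d p q :=
    sq_sqrt_sub_sqrt_le_of_posSemidef hR _ _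
  have hdiag (p q : n) : √(R (p, q) (p, q)).re ^ 2 = (R (p, q) (p, q)).re :=
    Real.sq_sqrt (Complex.nonneg_iff.1 hR.diag_nonneg).1
  have hsum : 2 * ∑ q, d i q ≤ ∑ p, ∑ q, d p q := by
    refine two_mul_sum_le_sum_sum (fun p q => (sq_nonneg _).trans (hsqrt p q))
      (fun p q => ?_) i (by simp only [d]; ring)
    simp only [d, ← hR.1.apply (p, q) (q, p), Complex.star_def, Complex.conj_re]
    ring
  have htri : (√(traceB R i i).re - √(traceA R i i).re) ^ 2 ≤ ∑ q, d i q :=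
    calc _ ≤ ∑ q, (√(R (i, q) (i, q)).re - √(R (q, i) (q, i)).re) ^ 2 := by
          simpa only [traceB, traceA, Matrix.of_apply, Complex.re_sum, hdiag] using
            sq_sqrt_sum_sub_sqrt_sum_le (fun q => √(R (i, q) (i, q)).re)
              fun q => √(R (q, i) (q, i)).re
      _ ≤ ∑ q, d i q := Finset.sum_le_sum fun q _ => hsqrt i q
  beta_reduce
  rw [re_trace_swapCost_mul hR.1]
  linarith

end LowerBound

section UpperBound

lemma half_sq_sub_mem_costs {P Q k : ℝ} (h : P ^ 2 + Q ^ 2 + k ^ 2 ≤ 1) :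
    (P - Q) ^ 2 / 2 ∈ costs (swapCost (Fin 2))
      (!![P ^ 2, k * P; k * P, 1 - P ^ 2].map Complex.ofReal)
      (!![Q ^ 2, k * Q; k * Q, 1 - Q ^ 2].map Complex.ofReal) := by
  -- the vector `(0, P, Q, k)` produces the coherences; the missing mass is put on `|11⟩⟨11|`
  let w : Fin 2 → Fin 2 → ℝ := !![0, P; Q, k]
  let d : Fin 2 → Fin 2 → ℝ := !![0, 0; 0, 1 - P ^ 2 - Q ^ 2 - k ^ 2]
  let R : Matrix (Fin 2 × Fin 2) (Fin 2 × Fin 2) ℂ :=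
    Matrix.of fun i j => ((w i.1 i.2 * w j.1 j.2 + if i = j then d i.1 i.2 else 0 : ℝ) : ℂ)
  have hpos : R.PosSemidef := by
    have hd : ∀ i j, 0 ≤ d i j := by
      have he : 0 ≤ 1 - P ^ 2 - Q ^ 2 - k ^ 2 := by linarith
      simpa [Fin.forall_fin_two, d] using he
    convert (Matrix.posSemidef_vecMulVec_self_star fun i : Fin 2 × Fin 2 => (w i.1 i.2 : ℂ)).add
      (.diagonal fun i : Fin 2 × Fin 2 => Complex.zero_le_real.2 (hd i.1 i.2)) using 1
    ext i j
    simp [R, Matrix.vecMulVec_apply, Matrix.diagonal_apply, apply_ite Complex.ofReal]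
  refine ⟨R, ⟨⟨hpos, ?_⟩, ?_, ?_⟩, ?_⟩
  · simp [Matrix.trace, Fintype.sum_prod_type, R, w, d]
    ring
  · ext i j
    fin_cases i <;> fin_cases j <;> simp [traceB, R, w, d] <;> ring
  · ext i j
    fin_cases i <;> fin_cases j <;> simp [traceA, R, w, d] <;> ring
  · beta_reduce
    rw [re_trace_swapCost_mul hpos.1]
    simp [R, w, d]
    ring

end UpperBound

section Qubit

/-- The population `⟨0|ρ|0⟩` of the state `ρ = qubit r ψ`. -/
noncomputable def population (r ψ : ℝ) : ℝ :=
  (1 + (2 * r - 1) * cos ψ) / 2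

/-- The coherence `⟨0|ρ|1⟩` of the state `ρ = qubit r ψ`. -/
noncomputable def coherence (r ψ : ℝ) : ℝ :=
  (2 * r - 1) * sin ψ / 2

lemma population_add (r ψ δ : ℝ) :
    population r (ψ + δ) = population r ψ * cos (δ / 2) ^ 2
      - 2 * coherence r ψ * cos (δ / 2) * sin (δ / 2)
      + (1 - population r ψ) * sin (δ / 2) ^ 2 := by
  obtain ⟨ω, rfl⟩ : ∃ ω, δ = 2 * ω := ⟨δ / 2, by ring⟩
  rw [population, cos_add, cos_two_mul', sin_two_mul, mul_div_cancel_left₀ ω two_ne_zero,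
    population, coherence]
  linear_combination (-1 / 2 : ℝ) * sin_sq_add_cos_sq ω

lemma coherence_eq_population_sub (r ψ : ℝ) :
    coherence r ψ = population r (ψ - π / 2) - 1 / 2 := by
  rw [coherence, population, cos_sub_pi_div_two]
  ring

lemma population_pos {r : ℝ} (hr : r ∈ Set.Ioo 0 1) (ψ : ℝ) : 0 < population r ψ := by
  have hconvex : 0 < r * (1 + cos ψ) + (1 - r) * (1 - cos ψ) := by
    obtain h | h := (neg_one_le_cos ψ).eq_or_lt
    · rw [← h]
      linarith [hr.2]
    · exact add_pos_of_pos_of_nonneg (mul_pos hr.1 (by linarith))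
        (mul_nonneg (by linarith [hr.2]) (by linarith [cos_le_one ψ]))
  rw [population]
  linarith

lemma continuous_population (r : ℝ) : Continuous (population r) := by
  unfold population
  fun_prop

lemma hasDerivAt_population (r ψ : ℝ) : HasDerivAt (population r) (-coherence r ψ) ψ := by
  unfold population coherence
  exact ((((hasDerivAt_cos ψ).const_mul (2 * r - 1)).const_add 1).div_const 2).congr_deriv (by ring)

lemma population_periodic (r : ℝ) : (population r).Periodic (2 * π) := fun ψ => by
  simp only [population, cos_add_two_pi]

lemma conjTranspose_map_ofReal {m n : Type*} (A : Matrix m n ℝ) :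
    (A.map Complex.ofReal)ᴴ = Aᵀ.map Complex.ofReal :=
  Matrix.ext fun _ _ => Complex.conj_ofReal _

lemma map_ofReal_mul {l m n : Type*} [Fintype m] (A : Matrix l m ℝ) (B : Matrix m n ℝ) :
    (A * B).map Complex.ofReal = A.map Complex.ofReal * B.map Complex.ofReal :=
  Matrix.map_mul (f := Complex.ofRealHom)

lemma rot_add (α β : ℝ) : rot (α + β) = rot α * rot β := by
  rw [rot, rot, rot, Matrix.mul_fin_two, add_div, cos_add, sin_add]
  congr! 1
  ring_nf

lemma rot_transpose (α : ℝ) : (rot α)ᵀ = rot (-α) := by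
  ext i j
  fin_cases i <;> fin_cases j <;> simp [rot, neg_div]

lemma map_rot_mem_unitaryGroup (φ : ℝ) :
    (rot φ).map Complex.ofReal ∈ Matrix.unitaryGroup (Fin 2) ℂ := by
  have hone : rot φ * (rot φ)ᵀ = 1 := by
    rw [rot_transpose, ← rot_add, add_neg_cancel, rot, Matrix.one_fin_two]
    simp
  rw [Matrix.mem_unitaryGroup_iff, Matrix.star_eq_conjTranspose, conjTranspose_map_ofReal,
    ← map_ofReal_mul, hone, Matrix.map_one _ Complex.ofReal_zero Complex.ofReal_one]

lemma qubit_eq (r θ : ℝ) :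
    qubit r θ = !![population r θ, coherence r θ; coherence r θ, 1 - population r θ].map
      Complex.ofReal := by
  obtain ⟨ω, rfl⟩ : ∃ ω, θ = 2 * ω := ⟨θ / 2, by ring⟩
  have hone := sin_sq_add_cos_sq ω
  rw [qubit, rot_transpose, rot, rot, mul_div_cancel_left₀ ω two_ne_zero, population, coherence,
    cos_two_mul', sin_two_mul, Matrix.mul_fin_two, Matrix.mul_fin_two, neg_div,
    mul_div_cancel_left₀ ω two_ne_zero, cos_neg, sin_neg]
  congr 6
  · linear_combination (1 / 2 : ℝ) * hone
  · ring
  · ring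
  · linear_combination (1 / 2 : ℝ) * hone

lemma gFun_eq (s r θ φ : ℝ) :
    gFun s r θ φ = (√(population s φ) - √(population r (θ + φ))) ^ 2 / 2 := by
  have h2 : √2 ^ 2 = (2 : ℝ) := sq_sqrt zero_le_two
  rw [gFun, population, population, sqrt_div' _ zero_le_two, sqrt_div' _ zero_le_two,
    ← sub_div, div_pow, h2]
  ring

lemma qubit_add (r θ φ : ℝ) :
    qubit r (θ + φ) = (rot φ).map Complex.ofReal * qubit r θ *
      ((rot φ).map Complex.ofReal)ᴴ := by
  rw [qubit, add_comm, rot_add, Matrix.transpose_mul, conjTranspose_map_ofReal, qubit,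
    ← map_ofReal_mul, ← map_ofReal_mul]
  simp only [Matrix.mul_assoc]

lemma costs_qubit_add (s α r β φ : ℝ) :
    costs (swapCost (Fin 2)) (qubit s (α + φ)) (qubit r (β + φ)) =
      costs (swapCost (Fin 2)) (qubit s α) (qubit r β) := by
  rw [qubit_add, qubit_add, costs_swapCost_conj (map_rot_mem_unitaryGroup φ)]

lemma gFun_le_of_mem_costs {s r θ c : ℝ}
    (hc : c ∈ costs (swapCost (Fin 2)) (qubit s 0) (qubit r θ)) (φ : ℝ) :
    gFun s r θ φ ≤ c := by
  rw [← costs_qubit_add s 0 r θ φ, zero_add, qubit_eq, qubit_eq] at hc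
  rw [gFun_eq]
  simpa using half_sq_sqrt_sub_sqrt_le hc 0

end Qubit

section Multiplier

variable {s r α β : ℝ}

/-- Some `k` is the common ratio of coherence to square root of population of the states
`qubit s α` and `qubit r β`, and is small enough for `half_sq_sub_mem_costs` to produce a coupling
of the two. -/
def HasMultiplier (s α r β : ℝ) : Prop :=
  ∃ k, coherence s α = k * √(population s α) ∧ coherence r β = k * √(population r β) ∧
    population s α + population r β + k ^ 2 ≤ 1

lemma HasMultiplier.symm (h : HasMultiplier s α r β) : HasMultiplier r β s α := by
  obtain ⟨k, hs, hr, hle⟩ := h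
  exact ⟨k, hr, hs, by rwa [add_comm (population r β)]⟩

lemma hasDerivAt_sqrt_population (hs : s ∈ Set.Ioo 0 1) (α : ℝ) :
    HasDerivAt (fun δ => √(population s (α + δ)))
      (-(coherence s α / √(population s α)) / 2) 0 := by
  have hshift : HasDerivAt (fun δ => population s (α + δ)) (-coherence s α) 0 := by
    simpa using (hasDerivAt_population s (α + 0)).comp_const_add α 0
  refine (hshift.sqrt (population_pos hs _).ne').congr_deriv ?_
  rw [add_zero, mul_comm, ← div_div, neg_div]

lemma coherence_div_sqrt_population_eq (hs : s ∈ Set.Ioo 0 1) (hr : r ∈ Set.Ioo 0 1)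
    (hmax : IsLocalMax (fun δ => √(population s (α + δ)) - √(population r (β + δ))) 0) :
    coherence s α / √(population s α) = coherence r β / √(population r β) := by
  have hcrit := hmax.hasDerivAt_eq_zero
    ((hasDerivAt_sqrt_population hs α).sub (hasDerivAt_sqrt_population hr β))
  linarith

lemma sq_mul_population_add {P Q k N ω : ℝ} (hP : population s α = P ^ 2)
    (hk : coherence s α = k * P) (hcos : N * cos ω = k) (hsin : N * sin ω = P + Q) :
    N ^ 2 * population s (α + 2 * ω) =
      k ^ 2 * Q ^ 2 + (P + Q) ^ 2 * (1 - P ^ 2 - k ^ 2) := by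
  rw [population_add, mul_div_cancel_left₀ ω two_ne_zero, hk, hP]
  linear_combination (P ^ 2 * (N * cos ω + k) - 2 * k * P * (N * sin ω)) * hcos +
    ((1 - P ^ 2) * (N * sin ω + (P + Q)) - 2 * k ^ 2 * P) * hsin

lemma population_add_population_add_sq_le_one {k : ℝ} (hs : s ∈ Set.Ioo 0 1)
    (hr : r ∈ Set.Ioo 0 1) (hlt : population r β < population s α)
    (hks : coherence s α = k * √(population s α)) (hkr : coherence r β = k * √(population r β))
    (hmax : ∀ δ, √(population r (β + δ)) - √(population s (α + δ)) ≤
      √(population s α) - √(population r β)) :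
    population s α + population r β + k ^ 2 ≤ 1 := by
  set P := √(population s α)
  set Q := √(population r β)
  have hP : population s α = P ^ 2 := (sq_sqrt (population_pos hs α).le).symm
  have hQ : population r β = Q ^ 2 := (sq_sqrt (population_pos hr β).le).symm
  have hQ0 : 0 < Q := sqrt_pos.2 (population_pos hr β)
  have hQP : Q < P := sqrt_lt_sqrt (population_pos hr β).le hlt
  -- rotating by `2 * ω` would exchange the two populations if `P ^ 2 + Q ^ 2 + k ^ 2` were `1`
  obtain ⟨ω, N, hN, hcos, hsin⟩ :
      ∃ ω N : ℝ, N ^ 2 = k ^ 2 + (P + Q) ^ 2 ∧ N * cos ω = k ∧ N * sin ω = P + Q := by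
    refine ⟨Complex.arg ⟨k, P + Q⟩, ‖(⟨k, P + Q⟩ : ℂ)‖, ?_, Complex.norm_mul_cos_arg _,
      Complex.norm_mul_sin_arg _⟩
    rw [Complex.sq_norm, Complex.normSq_mk]
    ring
  have hN0 : 0 < N ^ 2 := by rw [hN]; positivity
  have hA := sq_mul_population_add hP hks hcos hsin
  have hB := sq_mul_population_add hQ hkr hcos (hsin.trans (add_comm P Q))
  have hBA : population r (β + 2 * ω) - population s (α + 2 * ω) = P ^ 2 - Q ^ 2 := by
    refine mul_left_cancel₀ hN0.ne' ?_
    linear_combination hB - hA - (P ^ 2 - Q ^ 2) * hN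
  have hQA : Q ^ 2 ≤ population s (α + 2 * ω) := by
    have hδ := hmax (2 * ω)
    have hA2 := sq_sqrt (population_pos hs (α + 2 * ω)).le
    have hB2 := sq_sqrt (population_pos hr (β + 2 * ω)).le
    have hle : Q ≤ √(population s (α + 2 * ω)) := by
      have hA0 := sqrt_nonneg (population s (α + 2 * ω))
      nlinarith [sqrt_nonneg (population r (β + 2 * ω))]
    rw [← hA2]
    gcongr
  have hmain : (P + Q) ^ 2 * (P ^ 2 + Q ^ 2 + k ^ 2) ≤ (P + Q) ^ 2 * 1 := by
    nlinarith [mul_le_mul_of_nonneg_left hQA hN0.le]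
  rw [hP, hQ]
  exact le_of_mul_le_mul_left hmain (by positivity)

lemma hasMultiplier_of_population_lt (hs : s ∈ Set.Ioo 0 1) (hr : r ∈ Set.Ioo 0 1)
    (hlt : population r β < population s α)
    (hmax : ∀ δ, |√(population s (α + δ)) - √(population r (β + δ))| ≤
      √(population s α) - √(population r β)) :
    HasMultiplier s α r β := by
  have hlocal : IsLocalMax (fun δ => √(population s (α + δ)) - √(population r (β + δ))) 0 :=
    .of_forall fun δ => by simpa only [add_zero] using (le_abs_self _).trans (hmax δ)
  have hratio := coherence_div_sqrt_population_eq hs hr hlocal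
  have hP : √(population s α) ≠ 0 := (sqrt_pos.2 (population_pos hs α)).ne'
  have hQ : √(population r β) ≠ 0 := (sqrt_pos.2 (population_pos hr β)).ne'
  have hks := (div_mul_cancel₀ (coherence s α) hP).symm
  have hkr := (div_mul_cancel₀ (coherence r β) hQ).symm
  rw [← hratio] at hkr
  refine ⟨_, hks, hkr, population_add_population_add_sq_le_one hs hr hlt hks hkr fun δ => ?_⟩
  exact (le_abs_self _).trans ((abs_sub_comm _ _).trans_le (hmax δ))

lemma hasMultiplier_of_population_ne (hs : s ∈ Set.Ioo 0 1) (hr : r ∈ Set.Ioo 0 1)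
    (hne : population s α ≠ population r β)
    (hmax : ∀ δ, |√(population s (α + δ)) - √(population r (β + δ))| ≤
      |√(population s α) - √(population r β)|) :
    HasMultiplier s α r β := by
  obtain hlt | hlt := hne.lt_or_gt
  · refine (hasMultiplier_of_population_lt hr hs hlt fun δ => ?_).symm
    rw [abs_sub_comm, ← abs_of_nonneg (sub_nonneg.2 (sqrt_le_sqrt hlt.le)),
      abs_sub_comm √(population r β)]
    exact hmax δ
  · refine hasMultiplier_of_population_lt hs hr hlt fun δ => ?_
    rw [← abs_of_nonneg (sub_nonneg.2 (sqrt_le_sqrt hlt.le))]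
    exact hmax δ

lemma exists_hasMultiplier_of_population_eq {θ : ℝ}
    (heq : ∀ φ, population s φ = population r (θ + φ)) :
    ∃ φ ∈ Set.Ico 0 (2 * π), HasMultiplier s φ r (θ + φ) := by
  have hcoh (φ : ℝ) : coherence s φ = coherence r (θ + φ) := by
    rw [coherence_eq_population_sub, coherence_eq_population_sub, heq, add_sub_assoc]
  obtain ⟨φ, hφ, hsin, hle⟩ : ∃ φ ∈ Set.Ico 0 (2 * π), sin φ = 0 ∧ population s φ ≤ 1 / 2 := by
    obtain h | h := le_total s (1 / 2)
    · exact ⟨0, ⟨le_rfl, two_pi_pos⟩, sin_zero, by rw [population, cos_zero]; linarith⟩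
    · refine ⟨π, ⟨pi_nonneg, by linarith [pi_pos]⟩, sin_pi, ?_⟩
      rw [population, cos_pi]
      linarith
  have h0 : coherence s φ = 0 := by rw [coherence, hsin, mul_zero, zero_div]
  refine ⟨φ, hφ, 0, by rw [h0, zero_mul], by rw [← hcoh, h0, zero_mul], ?_⟩
  rw [← heq]
  linarith

lemma exists_mem_Ico_forall_abs_le (s r θ : ℝ) :
    ∃ φ ∈ Set.Ico 0 (2 * π), ∀ ψ, |√(population s ψ) - √(population r (θ + ψ))| ≤
      |√(population s φ) - √(population r (θ + φ))| := by
  let g ψ := |√(population s ψ) - √(population r (θ + ψ))|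
  have hper : g.Periodic (2 * π) := fun ψ => by
    simp only [g, ← add_assoc, population_periodic _ _]
  have hcont : Continuous g := by
    have := continuous_population s
    have := continuous_population r
    fun_prop
  obtain ⟨_, ⟨ψ, rfl⟩, hmax⟩ :=
    (hper.compact_of_continuous two_pi_pos.ne' hcont).exists_isGreatest (Set.range_nonempty g)
  obtain ⟨φ, hφ, hψφ⟩ := hper.exists_mem_Ico₀ two_pi_pos ψ
  exact ⟨φ, hφ, fun x => (hmax ⟨x, rfl⟩).trans_eq hψφ⟩

lemma exists_hasMultiplier (hs : s ∈ Set.Ioo 0 1) (hr : r ∈ Set.Ioo 0 1) (θ : ℝ) :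
    ∃ φ ∈ Set.Ico 0 (2 * π), HasMultiplier s φ r (θ + φ) := by
  obtain ⟨φ, hφ, hmax⟩ := exists_mem_Ico_forall_abs_le s r θ
  by_cases hne : population s φ = population r (θ + φ)
  · refine exists_hasMultiplier_of_population_eq fun ψ => ?_
    have hψ := hmax ψ
    rw [hne, sub_self, abs_zero, abs_nonpos_iff, sub_eq_zero] at hψ
    exact (sqrt_inj (population_pos hs _).le (population_pos hr _).le).1 hψ
  · refine ⟨φ, hφ, hasMultiplier_of_population_ne hs hr hne fun δ => ?_⟩
    simpa only [add_assoc] using hmax (φ + δ)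

lemma HasMultiplier.gFun_mem_costs (hs : s ∈ Set.Ioo 0 1) (hr : r ∈ Set.Ioo 0 1) {θ φ : ℝ}
    (h : HasMultiplier s φ r (θ + φ)) :
    gFun s r θ φ ∈ costs (swapCost (Fin 2)) (qubit s 0) (qubit r θ) := by
  obtain ⟨k, hks, hkr, hle⟩ := h
  have hP := sq_sqrt (population_pos hs φ).le
  have hQ := sq_sqrt (population_pos hr (θ + φ)).le
  rw [← costs_qubit_add s 0 r θ φ, zero_add, qubit_eq, qubit_eq, gFun_eq, hks, hkr]
  rw [← hP, ← hQ] at hle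
  simpa only [hP, hQ] using half_sq_sub_mem_costs hle

end Multiplier

section Polynomial

open Polynomial

variable {s r : ℝ}

lemma phiEquation_iff (hs : s ∈ Set.Ioo 0 1) (hr : r ∈ Set.Ioo 0 1) (θ φ : ℝ) :
    PhiEquation s r θ φ ↔
      coherence s φ ^ 2 * population r (θ + φ) = coherence r (θ + φ) ^ 2 * population s φ := by
  have hpos {s : ℝ} (hs : s ∈ Set.Ioo 0 1) (φ : ℝ) : 1 + (2 * s - 1) * cos φ ≠ 0 := fun h =>
    (population_pos hs φ).ne' (by rw [population, h, zero_div])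
  rw [PhiEquation, div_eq_div_iff (hpos hs φ) (hpos hr (θ + φ))]
  unfold coherence population
  constructor <;> intro h
  · linear_combination h / 8
  · linear_combination 8 * h

lemma HasMultiplier.phiEquation (hs : s ∈ Set.Ioo 0 1) (hr : r ∈ Set.Ioo 0 1) {θ φ : ℝ}
    (h : HasMultiplier s φ r (θ + φ)) : PhiEquation s r θ φ := by
  obtain ⟨k, hks, hkr, -⟩ := h
  rw [phiEquation_iff hs hr, hks, hkr, mul_pow, mul_pow, sq_sqrt (population_pos hs φ).le,
    sq_sqrt (population_pos hr _).le]
  ring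

lemma exp_mul_I_population (r ψ : ℝ) :
    (2 * r - 1) * (Complex.exp (ψ * Complex.I) ^ 2 + 1) + 2 * Complex.exp (ψ * Complex.I) =
      4 * population r ψ * Complex.exp (ψ * Complex.I) := by
  have hone := Complex.sin_sq_add_cos_sq ψ
  rw [Complex.exp_mul_I, population]
  push_cast
  linear_combination (2 * r - 1) * (-hone + Complex.sin ψ ^ 2 * Complex.I_sq)

lemma exp_mul_I_coherence (r ψ : ℝ) :
    (2 * r - 1) * (Complex.exp (ψ * Complex.I) ^ 2 - 1) =
      4 * Complex.I * coherence r ψ * Complex.exp (ψ * Complex.I) := by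
  have hone := Complex.sin_sq_add_cos_sq ψ
  rw [Complex.exp_mul_I, coherence]
  push_cast
  linear_combination (2 * r - 1) * (hone - Complex.sin ψ ^ 2 * Complex.I_sq)

lemma eval_phiPoly (s r θ : ℝ) (z : ℂ) :
    (phiPoly s r θ).eval z =
      ((2 * s - 1) * (z ^ 2 + 1) + 2 * z) *
          ((2 * r - 1) * ((Complex.exp (θ * Complex.I) * z) ^ 2 - 1)) ^ 2 -
        Complex.exp (θ * Complex.I) * ((2 * s - 1) * (z ^ 2 - 1)) ^ 2 *
          ((2 * r - 1) * ((Complex.exp (θ * Complex.I) * z) ^ 2 + 1) +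
            2 * (Complex.exp (θ * Complex.I) * z)) := by
  simp only [phiPoly, eval_sub, eval_mul, eval_add, eval_pow, eval_C, eval_X, eval_one, eval_ofNat]
  ring

lemma eval_exp_phiPoly (s r θ φ : ℝ) :
    (phiPoly s r θ).eval (Complex.exp (φ * Complex.I)) =
      64 * Complex.exp (θ * Complex.I) ^ 2 * Complex.exp (φ * Complex.I) ^ 3 *
        (coherence s φ ^ 2 * population r (θ + φ) - coherence r (θ + φ) ^ 2 * population s φ :
          ℝ) := by
  have hpr := exp_mul_I_population r (θ + φ)
  have hcr := exp_mul_I_coherence r (θ + φ)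
  rw [Complex.ofReal_add, add_mul, Complex.exp_add] at hpr hcr
  rw [eval_phiPoly, exp_mul_I_population, exp_mul_I_coherence, hpr, hcr]
  push_cast
  linear_combination 64 * Complex.exp (θ * Complex.I) ^ 2 * Complex.exp (φ * Complex.I) ^ 3 *
    (population s φ * coherence r (θ + φ) ^ 2 - coherence s φ ^ 2 * population r (θ + φ)) *
      Complex.I_sq

lemma phiEquation_iff_eval_eq_zero (hs : s ∈ Set.Ioo 0 1) (hr : r ∈ Set.Ioo 0 1) (θ φ : ℝ) :
    PhiEquation s r θ φ ↔ (phiPoly s r θ).eval (Complex.exp (φ * Complex.I)) = 0 := by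
  rw [phiEquation_iff hs hr, eval_exp_phiPoly, mul_eq_zero, or_iff_right (by simp),
    Complex.ofReal_eq_zero, sub_eq_zero]

lemma natDegree_phiPoly_le (s r θ : ℝ) : (phiPoly s r θ).natDegree ≤ 6 := by
  rw [phiPoly]
  compute_degree

lemma qubit_eq_qubit_of_phiPoly_eq_zero (hs : s ∈ Set.Ioo 0 1) (hr : r ∈ Set.Ioo 0 1) {θ : ℝ}
    (h : phiPoly s r θ = 0) : qubit s 0 = qubit r θ := by
  have heq (φ : ℝ) := (phiEquation_iff hs hr θ φ).1
    ((phiEquation_iff_eval_eq_zero hs hr θ φ).2 (by rw [h, eval_zero]))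
  have hsin : (2 * r - 1) * sin θ = 0 := by
    have h0 := heq 0
    simp only [coherence, population, sin_zero, cos_zero, add_zero] at h0
    have : ((2 * r - 1) * sin θ) ^ 2 * s = 0 := by linear_combination -4 * h0
    simpa [hs.1.ne'] using this
  have hcross (φ : ℝ) : ((2 * s - 1) * sin φ) ^ 2 * (1 + (2 * r - 1) * cos θ * cos φ) =
      ((2 * r - 1) * cos θ * sin φ) ^ 2 * (1 + (2 * s - 1) * cos φ) := by
    have hφ := heq φ
    simp only [coherence, population, sin_add, cos_add] at hφ
    linear_combination 8 * hφ + ((2 * s - 1) ^ 2 * sin φ ^ 3 +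
      ((2 * r - 1) * sin θ * cos φ ^ 2 + 2 * ((2 * r - 1) * cos θ) * cos φ * sin φ) *
        (1 + (2 * s - 1) * cos φ)) * hsin
  have hcos : (2 * r - 1) * cos θ = 2 * s - 1 := by
    have hsq : (2 * s - 1) ^ 2 = ((2 * r - 1) * cos θ) ^ 2 := by
      simpa only [sin_pi_div_two, cos_pi_div_two, mul_one, mul_zero, add_zero] using
        hcross (π / 2)
    have hprod : (2 * s - 1) ^ 2 * ((2 * r - 1) * cos θ - (2 * s - 1)) = 0 := by
      have h3 := hcross (π / 3)
      rw [mul_pow, mul_pow, sq_sin_pi_div_three, cos_pi_div_three] at h3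
      linear_combination 8 / 3 * h3 - (2 + (2 * s - 1)) * hsq
    obtain h0 | h0 := mul_eq_zero.1 hprod
    · rw [h0, eq_comm, sq_eq_zero_iff] at hsq
      rw [hsq, sq_eq_zero_iff.1 h0]
    · exact sub_eq_zero.1 h0
  rw [qubit_eq, qubit_eq, population, population, coherence, coherence, hsin, hcos, cos_zero,
    sin_zero, mul_one, mul_zero]

lemma encard_phiSet_le (hs : s ∈ Set.Ioo 0 1) (hr : r ∈ Set.Ioo 0 1) {θ : ℝ}
    (hP : phiPoly s r θ ≠ 0) : (PhiSet s r θ).encard ≤ 6 := by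
  have hinj : Set.InjOn (fun φ : ℝ => Complex.exp (φ * Complex.I)) (PhiSet s r θ) :=
    fun φ hφ ψ hψ h => Circle.exp_injOn_Ico (sub_zero _).le hφ.1 hψ.1 (Circle.ext h)
  have hmaps : Set.MapsTo (fun φ : ℝ => Complex.exp (φ * Complex.I)) (PhiSet s r θ)
      ((phiPoly s r θ).rootSet ℂ) := fun φ hφ =>
    (mem_rootSet_of_ne hP).2 ((phiEquation_iff_eval_eq_zero hs hr θ φ).1 hφ.2)
  calc (PhiSet s r θ).encard ≤ ((phiPoly s r θ).rootSet ℂ).encard :=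
        Set.encard_le_encard_of_injOn hmaps hinj
    _ = ((phiPoly s r θ).rootSet ℂ).ncard := (rootSet_finite _ _).cast_ncard_eq.symm
    _ ≤ 6 := by exact_mod_cast (ncard_rootSet_le _ _).trans (natDegree_phiPoly_le s r θ)

end Polynomial

end QuantumTransport

theorem theorem7p4 (s r θ : ℝ) (hs : 0 < s ∧ s < 1) (hr : 0 < r ∧ r < 1)
    (hθ : 0 ≤ θ ∧ θ < 2 * Real.pi) :
    -- the transport cost is an attained minimum over all couplings
    IsLeast
      (QuantumTransport.costs (QuantumTransport.swapCost (Fin 2))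
        (QuantumTransport.qubit s 0) (QuantumTransport.qubit r θ))
      (QuantumTransport.transportCost (QuantumTransport.swapCost (Fin 2))
        (QuantumTransport.qubit s 0) (QuantumTransport.qubit r θ)) ∧
    -- and it is the attained maximum over the solutions of the trigonometric equation
    IsGreatest
      (QuantumTransport.gFun s r θ '' QuantumTransport.PhiSet s r θ)
      (QuantumTransport.transportCost (QuantumTransport.swapCost (Fin 2))
        (QuantumTransport.qubit s 0) (QuantumTransport.qubit r θ)) ∧
    -- the trigonometric equation is a polynomial equation of degree at most six in exp (i φ)
    (QuantumTransport.phiPoly s r θ).natDegree ≤ 6 ∧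
    (∀ φ : ℝ, QuantumTransport.PhiEquation s r θ φ ↔
      (QuantumTransport.phiPoly s r θ).eval (Complex.exp (φ * Complex.I)) = 0) ∧
    -- with at most six solutions unless the two states coincide
    (QuantumTransport.qubit s 0 ≠ QuantumTransport.qubit r θ →
      QuantumTransport.phiPoly s r θ ≠ 0 ∧ (QuantumTransport.PhiSet s r θ).encard ≤ 6) := by
  open QuantumTransport in
  obtain ⟨φ, hφ, hmult⟩ := exists_hasMultiplier hs hr θ
  have hmem := hmult.gFun_mem_costs hs hr
  have hleast : IsLeast (costs (swapCost (Fin 2)) (qubit s 0) (qubit r θ)) (gFun s r θ φ) :=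
    ⟨hmem, fun c hc => gFun_le_of_mem_costs hc φ⟩
  have hcost : transportCost (swapCost (Fin 2)) (qubit s 0) (qubit r θ) = gFun s r θ φ :=
    hleast.csInf_eq
  have hgreatest : IsGreatest (gFun s r θ '' PhiSet s r θ) (gFun s r θ φ) :=
    ⟨⟨φ, ⟨hφ, hmult.phiEquation hs hr⟩, rfl⟩, by
      rintro _ ⟨ψ, -, rfl⟩
      exact gFun_le_of_mem_costs hmem ψ⟩
  rw [hcost]
  refine ⟨hleast, hgreatest, natDegree_phiPoly_le s r θ, phiEquation_iff_eval_eq_zero hs hr θ,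
    fun hne => ?_⟩
  have hP : phiPoly s r θ ≠ 0 := mt (qubit_eq_qubit_of_phiPoly_eq_zero hs hr) hne
  exact ⟨hP, encard_phiSet_le hs hr hP⟩
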